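/- **Theorem.** Let $d\in\mathbb N$ and let $F\subset\mathbb R^d$ be non-empty and compact. Then $$\dim_{\mathrm L}F=\min_{E\in\mathcal G_F}\dim_{\mathrm H}E=\min_{E\in\mathcal G_F}\overline{\dim}_{\mathrm B}E ,$$ where in particular both minima are attained. Here $\dim_{\mathrm H}$ is the Hausdorff dimension. For bounded $A\subset\mathbb R^d$ and $r>0$, $N_r(A)$ is the smallest number of closed axis-parallel cubes of side length $r$ needed to cover $A$; the upper box dimension of $A$ is $\overline{\dim}_{\mathrm B}A=\limsup_{r\to0^+}\frac{-\log N_r(A)}{\log r}$; and the lower dimension of $F$ is $$\dim_{\mathrm L}F=\sup\Big\{s\ge 0:\ \exists\,C>0\ \ \forall\,R\in(0,1)\ \ \forall\,r\in(0,R)\ \ \forall\,x\in F,\quad N_r(B(x,R)\cap F)\ge C\,(R/r)^s\Big\},$$ where $B(x,R)$ is the closed Euclidean ball. Let $X=[0,1]^d$. A *miniset* of $F$ is a set $(\lambda F+t)\cap X$ with $\lambda\ge1$ and $t\in\mathbb R^d$. A *microset* of $F$ is a compact set $E\subseteq X$ that is the limit, in the Hausdorff metric, of a sequence of minisets of $F$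 (the empty set being at infinite distance from every non-empty set). The *gallery* $\mathcal G_F$ is the set of all microsets of $F$ that meet the interior of $X$. -/

import Mathlib

open Set Filter Topology Metric
open scoped ENNReal NNReal

noncomputable section

namespace Microset

/-- The closed axis-parallel cube `[a₁, a₁ + r] × ⋯ × [a_d, a_d + r]` in `ℝ^d`. -/
def cube {d : ℕ} (a : EuclideanSpace ℝ (Fin d)) (r : ℝ) : Set (EuclideanSpace ℝ (Fin d)) :=
  {x | ∀ i, a i ≤ x i ∧ x i ≤ a i + r}

/-- `X = [0,1]^d`. -/
def unitCube (d : ℕ) : Set (EuclideanSpace ℝ (Fin d)) := cube 0 1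

/-- `N_r(A)`: the smallest number of cubes of side length `r` needed to cover the set `A`.
It is only used for bounded `A` and `r > 0`, where a finite cover exists. -/
def coverNum {d : ℕ} (r : ℝ) (A : Set (EuclideanSpace ℝ (Fin d))) : ℕ :=
  sInf {n : ℕ | ∃ t : Finset (EuclideanSpace ℝ (Fin d)), t.card = n ∧ A ⊆ ⋃ a ∈ t, cube a r}

/-- The upper box dimension `limsup_{r → 0+} (- log N_r(A)) / log r`.
For `0 < r < 1` the quotient is nonnegative, so `ENNReal.ofReal` does not truncate it. -/
def upperBoxDim {d : ℕ} (A : Set (EuclideanSpace ℝ (Fin d))) : ℝ≥0∞ :=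
  limsup (fun r : ℝ => ENNReal.ofReal (-Real.log (coverNum r A : ℝ) / Real.log r)) (𝓝[>] 0)

/-- The lower dimension: the supremum of all `s ≥ 0` such that, for some `C > 0`,
`N_r(B(x,R) ∩ F) ≥ C (R/r)^s` for all `0 < R < 1`, `r ∈ (0,R)` and `x ∈ F`. -/
def lowerDim {d : ℕ} (F : Set (EuclideanSpace ℝ (Fin d))) : ℝ≥0∞ :=
  ⨆ (s : ℝ≥0) (_ : ∃ C : ℝ, 0 < C ∧ ∀ R : ℝ, 0 < R → R < 1 → ∀ r : ℝ, 0 < r → r < R →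
      ∀ x ∈ F, C * (R / r) ^ (s : ℝ) ≤ (coverNum r (closedBall x R ∩ F) : ℝ)), (s : ℝ≥0∞)

/-- `D` is a miniset of `F`: `D = (c F + t) ∩ [0,1]^d` for some `c ≥ 1` and `t ∈ ℝ^d`. -/
def IsMiniset {d : ℕ} (F D : Set (EuclideanSpace ℝ (Fin d))) : Prop :=
  ∃ c : ℝ, 1 ≤ c ∧ ∃ t : EuclideanSpace ℝ (Fin d), D = ((fun x => c • x + t) '' F) ∩ unitCube d

/-- `E` is a microset of `F`: a compact subset of `[0,1]^d` which is the limit of a sequence of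
minisets of `F` in the Hausdorff metric. The extended distance is used since a miniset may be
empty; the empty set is at infinite distance from every nonempty set. -/
def IsMicroset {d : ℕ} (F E : Set (EuclideanSpace ℝ (Fin d))) : Prop :=
  IsCompact E ∧ E ⊆ unitCube d ∧
    ∃ D : ℕ → Set (EuclideanSpace ℝ (Fin d)), (∀ n, IsMiniset F (D n)) ∧
      Tendsto (fun n => hausdorffEDist (D n) E) atTop (𝓝 0)

/-- The gallery of `F`: the microsets of `F` which meet the interior of `[0,1]^d`. -/
def gallery {d : ℕ} (F : Set (EuclideanSpace ℝ (Fin d))) :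
    Set (Set (EuclideanSpace ℝ (Fin d))) :=
  {E | IsMicroset F E ∧ (E ∩ interior (unitCube d)).Nonempty}

end Microset

end

/-! The proof closes the chain `lowerDim F ≤ dimH E ≤ upperBoxDim E` for every `E` in the gallery,
with `upperBoxDim E ≤ lowerDim F` for one such `E`. Cover numbers are traded for separated sets,
which survive similarities and small Hausdorff perturbations.

Lower bound: the homogeneity of `F` is scale invariant, so it passes to microsets near a point of
the open cube (`IsMicroset.exists_isSep`). It gives a self-similar tree of well-separated points in
`E`; reading the branches as digits maps a subset of `E` onto `[0,1]` by a Hölder map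
(`le_dimH_of_branching`).

Attainment: for `t > lowerDim F` homogeneity fails. If every ball were rich at some scale within a
ratio `η`, concatenating these scales would restore homogeneity; hence some ball is sparse at all
those scales (`exists_sparse_ball`). Magnify it to the unit cube, let `η → 0` and `t → lowerDim F`,
and take a Hausdorff limit. -/

namespace Microset

/-- The points of the finite set `S` are at pairwise distance at least `δ`. -/
def IsSep {Y : Type*} [MetricSpace Y] (δ : ℝ) (S : Finset Y) : Prop :=
  (S : Set Y).Pairwise fun x y => δ ≤ dist x y

/-! ### Separated sets and a tree criterion for Hausdorff dimension -/

section Separated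

variable {Y : Type*} [MetricSpace Y]

theorem IsSep.anti {δ δ' : ℝ} {S : Finset Y} (h : IsSep δ S) (hδ : δ' ≤ δ) : IsSep δ' S :=
  fun _ hx _ hy hxy => hδ.trans (h hx hy hxy)

theorem isSep_singleton (δ : ℝ) (x : Y) : IsSep δ {x} := by
  simp [IsSep]

/-- A separated set can be moved to a nearby set, at the cost of some separation. -/
theorem IsSep.exists_perturb {δ ε : ℝ} {A B : Set Y} {S : Finset Y} (hS : IsSep δ S)
    (hSA : (S : Set Y) ⊆ A) (hε : 2 * ε < δ) (hAB : hausdorffEDist A B < ENNReal.ofReal ε) :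
    ∃ T : Finset Y, (T : Set Y) ⊆ B ∧ T.card = S.card ∧ IsSep (δ - 2 * ε) T ∧
      ∀ y ∈ T, ∃ x ∈ S, dist x y < ε := by
  classical
  have h : ∀ x ∈ A, ∃ y ∈ B, dist x y < ε := fun x hx => by
    obtain ⟨y, hy, hxy⟩ := exists_edist_lt_of_hausdorffEDist_lt hx hAB
    refine ⟨y, hy, ?_⟩
    rw [edist_dist] at hxy
    exact (ENNReal.ofReal_lt_ofReal_iff_of_nonneg dist_nonneg).1 hxy
  choose! f hfB hf using h
  have key : ∀ x ∈ S, ∀ y ∈ S, x ≠ y → δ - 2 * ε ≤ dist (f x) (f y) := by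
    intro x hx y hy hxy
    have h1 := hS hx hy hxy
    have h2 := hf x (hSA hx)
    have h3 := hf y (hSA hy)
    have h4 := dist_triangle4 x (f x) (f y) y
    rw [dist_comm (f y) y] at h4
    linarith
  refine ⟨S.image f, ?_, ?_, ?_, ?_⟩
  · intro y hy
    obtain ⟨x, hx, rfl⟩ := Finset.mem_image.1 (Finset.mem_coe.1 hy)
    exact hfB x (hSA hx)
  · refine Finset.card_image_of_injOn fun x hx y hy hxy => ?_
    by_contra hne
    have := key x hx y hy hne
    rw [hxy, dist_self] at this
    linarith
  · intro a ha b hb hab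
    obtain ⟨x, hx, rfl⟩ := Finset.mem_image.1 (Finset.mem_coe.1 ha)
    obtain ⟨y, hy, rfl⟩ := Finset.mem_image.1 (Finset.mem_coe.1 hb)
    exact key x hx y hy fun h => hab (congrArg f h)
  · intro y hy
    obtain ⟨x, hx, rfl⟩ := Finset.mem_image.1 hy
    exact ⟨x, hx, hf x (hSA hx)⟩

/-- A set in which every ball `B(y, R)` around a point near `z` contains `M ≥ η ^ (-s)` points
that are `4 η R`-separated has Hausdorff dimension at least `s`. -/
theorem le_dimH_of_branching {E : Set Y} (hE : IsComplete E) {z : Y} (hz : z ∈ E)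
    {R₀ η : ℝ} {s : ℝ≥0} {M : ℕ} (hR₀ : 0 < R₀) (hη : 0 < η) (hη' : η ≤ 1 / 2) (hs : 0 < s)
    (hM : η ^ (-(s : ℝ)) ≤ M)
    (h : ∀ y ∈ E, dist y z ≤ R₀ → ∀ R, 0 < R → R ≤ R₀ → ∃ p : Fin M → Y,
      (∀ i, p i ∈ E ∧ dist y (p i) ≤ R / 2) ∧ ∀ i j, i ≠ j → 4 * η * R ≤ dist (p i) (p j)) :
    (s : ℝ≥0∞) ≤ dimH E := by
  have hs' : (0 : ℝ) < s := hs
  have hη1 : η < 1 := by linarith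
  have hM1 : 1 < M := by
    have : (1 : ℝ) < M := (Real.one_lt_rpow_of_pos_of_lt_one_of_neg hη hη1 (by simpa)).trans_le hM
    exact_mod_cast this
  choose! p hp hsep using h
  -- Branch `w` of the tree rooted at `z`: the level-`n` node has radius `R₀ * η ^ n`, and the digit
  -- `w n` selects its child.
  let node : (ℕ → Fin M) → ℕ → Y := fun w n =>
    Nat.rec z (fun n y => p y (R₀ * η ^ n) (w n)) n
  have node_succ : ∀ w n, node w (n + 1) = p (node w n) (R₀ * η ^ n) (w n) := fun _ _ => rfl
  have hpos : ∀ n, 0 < R₀ * η ^ n := fun n => by positivity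
  have hle : ∀ n, R₀ * η ^ n ≤ R₀ := fun n =>
    mul_le_of_le_one_right hR₀.le (pow_le_one₀ hη.le hη1.le)
  -- As `η ≤ 1 / 2`, a displacement of half the radius is at most the drop in radius, so the bound
  -- telescopes.
  have inv : ∀ w n, node w n ∈ E ∧ dist (node w n) z ≤ R₀ * (1 - η ^ n) := by
    intro w n
    induction n with
    | zero => simpa [node] using hz
    | succ n ih =>
      have h1 : dist (node w n) z ≤ R₀ := ih.2.trans (by nlinarith [hpos n])
      have h2 := hp (node w n) ih.1 h1 _ (hpos n) (hle n) (w n)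
      rw [node_succ]
      refine ⟨h2.1, (dist_triangle_left _ z (node w n)).trans ?_⟩
      have h3 : R₀ * η ^ (n + 1) ≤ R₀ * η ^ n * (1 / 2) := by
        rw [pow_succ, ← mul_assoc]
        exact mul_le_mul_of_nonneg_left hη' (hpos n).le
      linarith [h2.2, ih.2]
  have near : ∀ w n, dist (node w n) z ≤ R₀ := fun w n =>
    (inv w n).2.trans (by nlinarith [hpos n])
  have step : ∀ w n, dist (node w n) (node w (n + 1)) ≤ R₀ / 2 * η ^ n := fun w n => by
    have := (hp (node w n) (inv w n).1 (near w n) _ (hpos n) (hle n) (w n)).2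
    rw [node_succ]
    linarith
  have lim : ∀ w, ∃ y ∈ E, Tendsto (node w) atTop (𝓝 y) := fun w =>
    cauchySeq_tendsto_of_isComplete hE (fun n => (inv w n).1)
      (cauchySeq_of_le_geometric η (R₀ / 2) hη1 (step w))
  choose g hgE hg using lim
  have near_lim : ∀ w n, dist (node w n) (g w) ≤ R₀ * η ^ n := fun w n => by
    refine (dist_le_of_le_geometric_of_tendsto η (R₀ / 2) hη1 (step w) (hg w) n).trans ?_
    rw [div_le_iff₀ (by linarith)]
    nlinarith [hpos n]
  have node_congr : ∀ w w' n, (∀ i < n, w i = w' i) → node w n = node w' n := by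
    intro w w' n
    induction n with
    | zero => intro _; rfl
    | succ n ih =>
      intro hi
      rw [node_succ, node_succ, ih fun i hin => hi i (by omega), hi n (by omega)]
  -- With `R` the level-`n` radius, siblings are `4ηR` apart and each limit lies within `ηR` of its
  -- node, leaving `2ηR`.
  have far : ∀ w w' n, (∀ i < n, w i = w' i) → w n ≠ w' n →
      2 * R₀ * η * η ^ n ≤ dist (g w) (g w') := by
    intro w w' n hlt hn
    have h1 := hsep (node w n) (inv w n).1 (near w n) _ (hpos n) (hle n) (w n) (w' n) hn
    have h2 : node w' (n + 1) = p (node w n) (R₀ * η ^ n) (w' n) := by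
      rw [node_succ, node_congr w w' n hlt]
    rw [← node_succ, ← h2] at h1
    have h3 := near_lim w (n + 1)
    have h4 := near_lim w' (n + 1)
    have h5 := dist_triangle4 (node w (n + 1)) (g w) (g w') (node w' (n + 1))
    rw [dist_comm (g w') (node w' (n + 1))] at h5
    rw [pow_succ] at h3 h4
    nlinarith
  have first : ∀ w w' : ℕ → Fin M, w ≠ w' → ∃ n, (∀ i < n, w i = w' i) ∧ w n ≠ w' n := by
    intro w w' hw
    classical
    have hex : ∃ n, w n ≠ w' n := Function.ne_iff.1 hw
    exact ⟨Nat.find hex, fun i hi => not_not.1 (Nat.find_min hex hi), Nat.find_spec hex⟩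
  have inj : Function.Injective g := by
    intro w w' hgw
    by_contra hw
    obtain ⟨n, h1, h2⟩ := first w w' hw
    have := far w w' n h1 h2
    rw [hgw, dist_self] at this
    have : 0 < 2 * R₀ * η * η ^ n := by positivity
    linarith
  have : Nonempty (ℕ → Fin M) := ⟨fun _ => ⟨0, by omega⟩⟩
  -- Read the branch ending at `y` as a base-`M` expansion. Agreement in `n` digits gives distance
  -- at most `M ^ (-n) ≤ η ^ (n s)`, which is the `s`-Hölder bound.
  let f : Y → ℝ := fun y => Real.ofDigits (Function.invFun g y)
  have hfg : ∀ w, f (g w) = Real.ofDigits w := fun w => by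
    simp only [f, Function.leftInverse_invFun inj w]
  have holder : HolderOnWith (Real.toNNReal ((2 * R₀ * η) ^ (-(s : ℝ)))) s f (range g) := by
    rintro _ ⟨w, rfl⟩ _ ⟨w', rfl⟩
    rw [hfg, hfg]
    rcases eq_or_ne w w' with rfl | hw
    · simp
    obtain ⟨n, h1, h2⟩ := first w w' hw
    have h3 := far w w' n h1 h2
    have h4 : dist (Real.ofDigits w) (Real.ofDigits w') ≤ ((M : ℝ) ^ n)⁻¹ :=
      Real.abs_ofDigits_sub_ofDigits_le h1
    have h5 : ((M : ℝ) ^ n)⁻¹ ≤ (2 * R₀ * η) ^ (-(s : ℝ)) * dist (g w) (g w') ^ (s : ℝ) := by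
      calc ((M : ℝ) ^ n)⁻¹ ≤ ((η ^ (-(s : ℝ))) ^ n)⁻¹ := by gcongr
        _ = (η ^ n) ^ (s : ℝ) := by
          rw [Real.rpow_neg hη.le, inv_pow, inv_inv, Real.rpow_pow_comm hη.le]
        _ = (2 * R₀ * η) ^ (-(s : ℝ)) * (2 * R₀ * η * η ^ n) ^ (s : ℝ) := by
          have h0 : 0 < 2 * R₀ * η := by positivity
          rw [Real.mul_rpow h0.le (by positivity), ← mul_assoc, ← Real.rpow_add h0]
          simp
        _ ≤ _ := by gcongr
    rw [edist_dist, edist_dist, ENNReal.ofReal_rpow_of_nonneg dist_nonneg s.coe_nonneg,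
      ENNReal.ofNNReal_toNNReal, ← ENNReal.ofReal_mul (by positivity)]
    exact ENNReal.ofReal_le_ofReal (h4.trans h5)
  have himage : Icc (0 : ℝ) 1 ⊆ f '' range g := by
    intro x hx
    obtain ⟨w, -, rfl⟩ := Real.ofDigits_SurjOn hM1 hx
    exact ⟨g w, ⟨w, rfl⟩, hfg w⟩
  have h1 : (1 : ℝ≥0∞) ≤ dimH E / s :=
    calc (1 : ℝ≥0∞) = dimH (Icc (0 : ℝ) 1) := by
          rw [Real.dimH_of_nonempty_interior (by simp)]; simp
      _ ≤ dimH (f '' range g) := dimH_mono himage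
      _ ≤ dimH (range g) / s := holder.dimH_image_le hs
      _ ≤ dimH E / s := ENNReal.div_le_div_right (dimH_mono (range_subset_iff.2 hgE)) _
  rwa [ENNReal.le_div_iff_mul_le (by simp [hs.ne']) (by simp), one_mul] at h1

end Separated

/-! ### Similarities -/

section Affine

variable {Y : Type*} [NormedAddCommGroup Y] [NormedSpace ℝ Y]

theorem dist_affine {c : ℝ} (hc : 0 ≤ c) (t x y : Y) :
    dist (c • x + t) (c • y + t) = c * dist x y := by
  rw [dist_add_right, dist_smul₀, Real.norm_of_nonneg hc]

theorem IsSep.image_affine {c δ : ℝ} (hc : 0 < c) {S : Finset Y} (hS : IsSep δ S) (t : Y) :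
    ∃ T : Finset Y, (T : Set Y) = (fun x => c • x + t) '' S ∧ T.card = S.card ∧
      IsSep (c * δ) T := by
  classical
  refine ⟨S.image fun x => c • x + t, by simp, Finset.card_image_of_injective _ fun x y hxy => ?_,
    ?_⟩
  · have := dist_affine hc.le t x y
    rw [show c • x + t = c • y + t from hxy, dist_self] at this
    exact dist_eq_zero.1 ((mul_eq_zero.1 this.symm).resolve_left hc.ne')
  · intro a ha b hb hab
    obtain ⟨x, hx, rfl⟩ := Finset.mem_image.1 (Finset.mem_coe.1 ha)
    obtain ⟨y, hy, rfl⟩ := Finset.mem_image.1 (Finset.mem_coe.1 hb)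
    simp only [dist_affine hc.le]
    exact mul_le_mul_of_nonneg_left (hS hx hy fun h => hab (by rw [h])) hc.le

end Affine

/-! ### Cover numbers, separated sets and box dimension -/

section Cover

variable {d : ℕ} {A : Set (EuclideanSpace ℝ (Fin d))} {r : ℝ}

theorem dist_le_of_mem_cube {a x y : EuclideanSpace ℝ (Fin d)} (hr : 0 ≤ r) (hx : x ∈ cube a r)
    (hy : y ∈ cube a r) : dist x y ≤ √d * r := by
  rw [EuclideanSpace.dist_eq]
  calc √(∑ i, dist (x i) (y i) ^ 2) ≤ √(∑ _i : Fin d, r ^ 2) := by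
        refine Real.sqrt_le_sqrt (Finset.sum_le_sum fun i _ => ?_)
        have : dist (x i) (y i) ≤ r := by
          rw [Real.dist_eq, abs_le]
          constructor <;> linarith [(hx i).1, (hx i).2, (hy i).1, (hy i).2]
        gcongr
    _ = √d * r := by
        rw [Finset.sum_const, Finset.card_univ, Fintype.card_fin, nsmul_eq_mul,
          Real.sqrt_mul (by positivity), Real.sqrt_sq hr]

theorem closedBall_subset_cube (x : EuclideanSpace ℝ (Fin d)) (r : ℝ) :
    closedBall x (r / 2) ⊆ cube (x - WithLp.toLp 2 fun _ => r / 2) r := by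
  intro y hy i
  have h1 : |y i - x i| ≤ r / 2 := by
    have := (PiLp.norm_apply_le (y - x) i).trans (mem_closedBall_iff_norm.1 hy)
    simpa using this
  rw [abs_le] at h1
  simp only [PiLp.sub_apply]
  constructor <;> linarith

theorem exists_card_eq_coverNum (hA : Bornology.IsBounded A) (hr : 0 < r) :
    ∃ t : Finset (EuclideanSpace ℝ (Fin d)), t.card = coverNum r A ∧ A ⊆ ⋃ a ∈ t, cube a r := by
  classical
  refine Nat.sInf_mem (s := {n : ℕ | ∃ t : Finset (EuclideanSpace ℝ (Fin d)), t.card = n ∧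
    A ⊆ ⋃ a ∈ t, cube a r}) ?_
  obtain ⟨t, htf, ht⟩ := Metric.totallyBounded_iff.1 
    (hA.isCompact_closure.totallyBounded.subset subset_closure) (r / 2) (by positivity)
  refine ⟨_, htf.toFinset.image fun x => x - WithLp.toLp 2 fun _ : Fin d => r / 2, rfl, fun x hx => ?_⟩
  obtain ⟨y, hy, hxy⟩ := mem_iUnion₂.1 (ht hx)
  exact mem_iUnion₂.2 ⟨_, Finset.mem_image_of_mem _ (htf.mem_toFinset.2 hy),
    closedBall_subset_cube y r (ball_subset_closedBall hxy)⟩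

theorem coverNum_le_card {t : Finset (EuclideanSpace ℝ (Fin d))} (ht : A ⊆ ⋃ a ∈ t, cube a r) :
    coverNum r A ≤ t.card :=
  Nat.sInf_le ⟨t, rfl, ht⟩

/-- A cube of side `r` has diameter at most `√d * r`, so it holds at most one point of `S`. -/
theorem IsSep.card_le_coverNum {δ : ℝ} {S : Finset (EuclideanSpace ℝ (Fin d))} (hS : IsSep δ S)
    (hSA : (S : Set _) ⊆ A) (hA : Bornology.IsBounded A) (hr : 0 < r) (hδ : √d * r < δ) :
    S.card ≤ coverNum r A := by
  obtain ⟨t, htc, ht⟩ := exists_card_eq_coverNum hA hr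
  rw [← htc]
  have : ∀ x ∈ S, ∃ a ∈ t, x ∈ cube a r := fun x hx => by
    simpa using ht (hSA hx)
  choose! f hft hf using this
  refine Finset.card_le_card_of_injOn f hft fun x hx y hy hxy => ?_
  by_contra hne
  have h1 := dist_le_of_mem_cube hr.le (hf x hx) (hxy ▸ hf y hy)
  linarith [hS hx hy hne]

/-- Greedy choice: the `r`-cubes centred at fewer than `coverNum r A` points cannot cover `A`, and a
missed point is at distance more than `r / 2` from all the centres. -/
theorem exists_isSep_card_eq_coverNum (hr : 0 < r) (A : Set (EuclideanSpace ℝ (Fin d))) :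
    ∃ S : Finset (EuclideanSpace ℝ (Fin d)), (S : Set _) ⊆ A ∧ IsSep (r / 2) S ∧
      S.card = coverNum r A := by
  classical
  suffices h : ∀ n ≤ coverNum r A, ∃ S : Finset (EuclideanSpace ℝ (Fin d)), (S : Set _) ⊆ A ∧
      IsSep (r / 2) S ∧ S.card = n from h _ le_rfl
  intro n
  induction n with
  | zero => exact fun _ => ⟨∅, by simp, by simp [IsSep], rfl⟩
  | succ n ih =>
    intro hn
    obtain ⟨S, hSA, hS, hSn⟩ := ih (by omega)
    have : ∃ x ∈ A, ∀ y ∈ S, r / 2 ≤ dist x y := by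
      by_contra! hcon
      have h1 : A ⊆ ⋃ a ∈ S.image fun x => x - WithLp.toLp 2 fun _ => r / 2, cube a r := by
        intro x hx
        obtain ⟨y, hy, hxy⟩ := hcon x hx
        exact mem_iUnion₂.2 ⟨_, Finset.mem_image_of_mem _ hy, closedBall_subset_cube y r hxy.le⟩
      have := (coverNum_le_card h1).trans Finset.card_image_le
      omega
    obtain ⟨x, hxA, hx⟩ := this
    have hxS : x ∉ S := fun hxS => by
      have := hx x hxS
      rw [dist_self] at this
      linarith
    refine ⟨insert x S, ?_, ?_, by rw [Finset.card_insert_of_notMem hxS, hSn]⟩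
    · simpa [Set.insert_subset_iff] using ⟨hxA, hSA⟩
    · rw [IsSep, Finset.coe_insert, Set.pairwise_insert]
      exact ⟨hS, fun y hy _ => ⟨hx y hy, dist_comm x y ▸ hx y hy⟩⟩

/-- The Hausdorff dimension is at most the upper box dimension. -/
theorem dimH_le_upperBoxDim (hA : Bornology.IsBounded A) : dimH A ≤ upperBoxDim A := by
  refine le_of_forall_gt_imp_ge_of_dense fun b hb => ?_
  induction b with
  | top => exact le_top
  | coe t =>
  refine dimH_le_of_hausdorffMeasure_ne_top ?_
  -- Since `t` exceeds the box dimension, optimal covers have bounded `t`-sums.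
  have ev : ∀ᶠ r : ℝ in 𝓝[>] 0, (0 < r ∧ (coverNum r A : ℝ) * r ^ (t : ℝ) ≤ 1) := by
    filter_upwards [eventually_lt_of_limsup_lt hb, Ioo_mem_nhdsGT zero_lt_one] with r hr hr01
    refine ⟨hr01.1, ?_⟩
    rcases Nat.eq_zero_or_pos (coverNum r A) with h0 | h0
    · simp [h0]
    have h0' : (0 : ℝ) < coverNum r A := by exact_mod_cast h0
    have hlog : Real.log r < 0 := Real.log_neg hr01.1 hr01.2
    have h1 : -Real.log (coverNum r A : ℝ) / Real.log r < t := by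
      rw [← ENNReal.ofReal_coe_nnreal] at hr
      exact (ENNReal.ofReal_lt_ofReal_iff'.1 hr).1
    rw [div_lt_iff_of_neg hlog] at h1
    rw [← Real.log_nonpos_iff (by have := hr01.1; positivity),
      Real.log_mul h0'.ne' (by have := hr01.1; positivity), Real.log_rpow hr01.1]
    linarith
  have hcov : ∀ r : ℝ, ∃ u : Finset (EuclideanSpace ℝ (Fin d)), 0 < r →
      u.card = coverNum r A ∧ A ⊆ ⋃ a ∈ u, cube a r := fun r => by
    by_cases hr : 0 < r
    · obtain ⟨u, hu⟩ := exists_card_eq_coverNum hA hr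
      exact ⟨u, fun _ => hu⟩
    · exact ⟨∅, fun h => absurd h hr⟩
  choose u hu using hcov
  have hdiam : ∀ r : ℝ, 0 < r → ∀ a : EuclideanSpace ℝ (Fin d),
      ediam (cube a r) ≤ ENNReal.ofReal (√d * r) := fun r hr a =>
    ediam_le fun x hx y hy => by
      rw [edist_dist]
      exact ENNReal.ofReal_le_ofReal (dist_le_of_mem_cube hr.le hx hy)
  have hlim : Tendsto (fun r : ℝ => ENNReal.ofReal (√d * r)) (𝓝[>] 0) (𝓝 0) := by
    have : Tendsto (fun r : ℝ => ENNReal.ofReal (√d * r)) (𝓝 0) (𝓝 (ENNReal.ofReal (√d * 0))) :=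
      (ENNReal.continuous_ofReal.comp (by fun_prop)).tendsto 0
    simpa using this.mono_left nhdsWithin_le_nhds
  have hmeas := MeasureTheory.Measure.hausdorffMeasure_le_liminf_sum (t : ℝ) A
    (l := 𝓝[>] (0 : ℝ)) _ hlim (fun r (a : u r) => cube (a : EuclideanSpace ℝ (Fin d)) r)
    (by filter_upwards [self_mem_nhdsWithin] with r hr a using hdiam r hr a)
    (by
      filter_upwards [self_mem_nhdsWithin] with r hr
      exact (hu r hr).2.trans (by simp [Set.iUnion_subtype]))
  refine ne_top_of_le_ne_top (b := ENNReal.ofReal ((√d) ^ (t : ℝ))) ENNReal.ofReal_ne_top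
    (hmeas.trans (liminf_le_of_frequently_le' (Eventually.frequently ?_)))
  filter_upwards [ev] with r ⟨hr, hN⟩
  calc ∑ a : u r, ediam (cube (a : EuclideanSpace ℝ (Fin d)) r) ^ (t : ℝ)
      ≤ ∑ _a : u r, ENNReal.ofReal (√d * r) ^ (t : ℝ) :=
        Finset.sum_le_sum fun a _ => ENNReal.rpow_le_rpow (hdiam r hr a) t.2
    _ = ENNReal.ofReal ((√d) ^ (t : ℝ) * ((coverNum r A : ℝ) * r ^ (t : ℝ))) := by
        rw [Finset.sum_const, Finset.card_univ, Fintype.card_coe, (hu r hr).1, nsmul_eq_mul,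
          ENNReal.ofReal_rpow_of_nonneg (by positivity) t.coe_nonneg, ← ENNReal.ofReal_natCast,
          ← ENNReal.ofReal_mul (by positivity), Real.mul_rpow (by positivity) hr.le]
        ring_nf
    _ ≤ ENNReal.ofReal ((√d) ^ (t : ℝ)) :=
        ENNReal.ofReal_le_ofReal (mul_le_of_le_one_right (by positivity) hN)

end Cover

/-! ### Lower bound for every gallery set -/

variable {d : ℕ} {E F : Set (EuclideanSpace ℝ (Fin d))}

/-- The homogeneity condition on `F` that defines the lower dimension. -/
def IsHomogeneous (F : Set (EuclideanSpace ℝ (Fin d))) (s C : ℝ) : Prop :=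
  ∀ R : ℝ, 0 < R → R < 1 → ∀ r : ℝ, 0 < r → r < R →
    ∀ x ∈ F, C * (R / r) ^ s ≤ (coverNum r (closedBall x R ∩ F) : ℝ)

/-- The homogeneity of `F` is inherited by a microset of `F`, away from the boundary of the
unit cube. -/
theorem IsMicroset.exists_isSep (hE : IsMicroset F E) {z : EuclideanSpace ℝ (Fin d)}
    (hz : z ∈ interior (unitCube d)) {s C : ℝ} (hF : IsHomogeneous F s C) :
    ∃ ρ : ℝ, 0 < ρ ∧ ∀ y ∈ E, dist y z ≤ ρ → ∀ R, R ≤ ρ → ∀ r, 0 < r → r < R →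
      ∃ S : Finset (EuclideanSpace ℝ (Fin d)), (S : Set _) ⊆ E ∩ closedBall y R ∧
        IsSep (r / 8) S ∧ C * (R / r) ^ s ≤ S.card := by
  obtain ⟨ρ, hρ, hball⟩ := Metric.isOpen_iff.1 isOpen_interior z hz
  refine ⟨min (ρ / 2) 1, by positivity, fun y hy hyz R hR r hr hrR => ?_⟩
  have hRρ : R ≤ ρ / 2 := hR.trans (min_le_left _ _)
  have hR1 : R ≤ 1 := hR.trans (min_le_right _ _)
  have hyρ : dist y z ≤ ρ / 2 := hyz.trans (min_le_left _ _)
  have hε : 0 < r / 16 := by positivity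
  obtain ⟨D, hD, hlim⟩ := hE.2.2
  obtain ⟨n, hn⟩ := (hlim.eventually (gt_mem_nhds (ENNReal.ofReal_pos.2 hε))).exists
  obtain ⟨c, hc, t, hDc⟩ := hD n
  rw [hDc] at hn
  have hc0 : 0 < c := by linarith
  obtain ⟨_, ⟨⟨x, hx, rfl⟩, -⟩, hyx⟩ :=
    exists_edist_lt_of_hausdorffEDist_lt hy (hausdorffEDist_comm.trans_lt hn)
  rw [edist_dist, ENNReal.ofReal_lt_ofReal_iff hε] at hyx
  have hR0 : 0 < R := hr.trans hrR
  -- Magnified by `c`, this gives points within `R / 2` of `c • x + t` and `r / 4`-separated. Moving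
  -- them by `r / 16` leaves separation `r / 8`, and the spare `R / 2` keeps them in the cube and in
  -- `closedBall y R`.
  have hcard := hF (R / (2 * c)) (by positivity) (by rw [div_lt_one (by positivity)]; linarith)
    (r / (2 * c)) (by positivity) (by gcongr) x hx
  rw [div_div_div_cancel_right₀ (by positivity)] at hcard
  obtain ⟨S, hSF, hS, hSc⟩ := exists_isSep_card_eq_coverNum (r := r / (2 * c)) (by positivity)
    (closedBall x (R / (2 * c)) ∩ F)
  obtain ⟨T, hT, hTc, hTs⟩ := hS.image_affine hc0 t
  have hTx : ∀ p ∈ T, dist p (c • x + t) ≤ R / 2 := fun p hp => by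
    obtain ⟨q, hq, rfl⟩ : p ∈ (fun x => c • x + t) '' S := hT ▸ hp
    have h := mul_le_mul_of_nonneg_left (mem_closedBall.1 (hSF hq).1) hc0.le
    rw [← dist_affine hc0.le t] at h
    exact h.trans_eq (by field_simp)
  have hTD : (T : Set _) ⊆ ((fun x => c • x + t) '' F) ∩ unitCube d := fun p hp => by
    refine ⟨image_mono (hSF.trans inter_subset_right) (hT ▸ hp), interior_subset (hball ?_)⟩
    rw [mem_ball]
    have h1 := dist_triangle4 p (c • x + t) y z
    rw [dist_comm _ y] at h1
    linarith [hTx p hp]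
  have hsep : c * (r / (2 * c) / 2) = r / 4 := by field_simp; norm_num
  rw [hsep] at hTs
  obtain ⟨U, hUE, hUc, hUs, hU⟩ := hTs.exists_perturb hTD (ε := r / 16) (by linarith) hn
  refine ⟨U, fun p hp => ⟨hUE hp, ?_⟩, hUs.anti (by linarith), by rwa [hUc, hTc, hSc]⟩
  obtain ⟨q, hq, hqp⟩ := hU p hp
  have h1 := dist_triangle4 p q (c • x + t) y
  rw [dist_comm p q, dist_comm (c • x + t) y] at h1
  rw [mem_closedBall]
  linarith [hTx q hq]

/-- The lower dimension of `F` is at most the Hausdorff dimension of each set of its gallery. -/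
theorem lowerDim_le_dimH (hE : E ∈ gallery F) : lowerDim F ≤ dimH E := by
  obtain ⟨hmic, z, hzE, hz⟩ := hE
  refine iSup₂_le fun s ⟨C, hC, hF⟩ => le_of_forall_lt_imp_le_of_dense fun a ha => ?_
  lift a to ℝ≥0 using ne_top_of_lt ha
  have has : (a : ℝ) < s := by exact_mod_cast ha
  rcases eq_zero_or_pos a with rfl | ha0
  · simp
  obtain ⟨ρ, hρ, h⟩ := hmic.exists_isSep hz (s := s) (C := C) hF
  have hlim : Tendsto (fun η : ℝ => (64 : ℝ) ^ (s : ℝ) * (2 / C) * η ^ ((s : ℝ) - a)) (𝓝[>] 0)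
      (𝓝 0) := by
    have h1 : ContinuousAt (fun η : ℝ => (64 : ℝ) ^ (s : ℝ) * (2 / C) * η ^ ((s : ℝ) - a)) 0 :=
      (Real.continuousAt_rpow_const _ _ (Or.inr (by linarith))).const_mul _
    have h2 := h1.tendsto.mono_left (nhdsWithin_le_nhds (s := Ioi (0 : ℝ)))
    rwa [Real.zero_rpow (by linarith), mul_zero] at h2
  -- The gap `s - a > 0` absorbs `C` and the constants once `η` is small.
  obtain ⟨η, hη1, hη⟩ := ((hlim.eventually (gt_mem_nhds zero_lt_one)).and
    (Ioo_mem_nhdsGT (show (0 : ℝ) < 1 / 64 by norm_num))).exists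
  have hη0 : 0 < η := hη.1
  have hη64 : η < 1 / 64 := hη.2
  have hMle : (⌈η ^ (-(a : ℝ))⌉₊ : ℝ) ≤ C * (1 / (64 * η)) ^ (s : ℝ) := by
    have h1 : 1 ≤ η ^ (-(a : ℝ)) :=
      Real.one_le_rpow_of_pos_of_le_one_of_nonpos hη0 (by linarith) (by simp)
    have h2 := (Nat.ceil_lt_add_one (show 0 ≤ η ^ (-(a : ℝ)) by positivity)).le
    have h3 : C * (1 / (64 * η)) ^ (s : ℝ) * ((64 : ℝ) ^ (s : ℝ) * (2 / C) * η ^ ((s : ℝ) - a))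
        = 2 * η ^ (-(a : ℝ)) := by
      rw [one_div, Real.inv_rpow (by positivity), Real.mul_rpow (by norm_num) hη0.le,
        Real.rpow_sub hη0, Real.rpow_neg hη0.le]
      field_simp
    have h4 : 2 * η ^ (-(a : ℝ)) ≤ C * (1 / (64 * η)) ^ (s : ℝ) := by
      rw [← h3]
      exact mul_le_of_le_one_right (by positivity) hη1.le
    linarith
  refine le_dimH_of_branching hmic.1.isComplete hzE hρ hη0 (by linarith) ha0
    (Nat.le_ceil _) fun y hy hyz R hR hRρ => ?_
  -- The scale `32 * η * R` yields separation `4 * η * R`, as the tree requires.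
  obtain ⟨S, hSE, hS, hSc⟩ := h y hy hyz (R / 2) (by linarith) (32 * η * R) (by positivity)
    (by nlinarith)
  have hcard : ⌈η ^ (-(a : ℝ))⌉₊ ≤ S.card := by
    rw [show R / 2 / (32 * η * R) = 1 / (64 * η) by field_simp; norm_num] at hSc
    exact_mod_cast hMle.trans hSc
  let e := (Fin.castLEEmb hcard).trans S.equivFin.symm.toEmbedding
  refine ⟨fun i => e i, fun i => ⟨(hSE (e i).2).1, ?_⟩, fun i j hij => ?_⟩
  · exact mem_closedBall'.1 (hSE (e i).2).2
  · refine le_trans (by linarith) (hS (e i).2 (e j).2 fun hij' => hij (e.injective ?_))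
    exact Subtype.ext hij'

/-! ### Construction of a minimising gallery set -/

/-- If every ball around a point of `F` contains many points of `F` that are separated at some
scale comparable to its radius, then balls contain many separated points at all scales. -/
theorem exists_isSep_of_forall_branching {Y : Type*} [MetricSpace Y] {F : Set Y} {t η : ℝ}
    (ht : 0 ≤ t) (hη : 0 < η) (hη1 : η ≤ 1)
    (h : ∀ x ∈ F, ∀ R, 0 < R → R < 1 → ∃ ρ, η * R ≤ ρ ∧ ρ ≤ R / 2 ∧ ∃ S : Finset Y,
      (S : Set Y) ⊆ closedBall x (R / 2) ∩ F ∧ IsSep (4 * ρ) S ∧ (R / ρ) ^ t ≤ S.card)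
    (m : ℕ) {r : ℝ} (hr : 0 < r) :
    ∀ R, 0 < R → R < 1 → R ≤ 2 ^ m * r → ∀ x ∈ F, ∃ S : Finset Y,
      (S : Set Y) ⊆ closedBall x R ∩ F ∧ IsSep r S ∧ (η * (R / r)) ^ t ≤ S.card := by
  classical
  induction m with
  | zero =>
    intro R hR hR1 hRr x hx
    refine ⟨{x}, by simpa using ⟨hR.le, hx⟩, isSep_singleton r x, ?_⟩
    rw [pow_zero, one_mul] at hRr
    simpa using Real.rpow_le_one (by positivity)
      (mul_le_one₀ hη1 (by positivity) ((div_le_one hr).2 hRr)) ht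
  | succ m ih =>
    intro R hR hR1 hRr x hx
    -- The factor `η` is lost only here, at the last scale, where one point suffices; the counts of
    -- the other scales multiply exactly.
    rcases le_or_gt (η * R) r with hle | hlt
    · refine ⟨{x}, by simpa using ⟨hR.le, hx⟩, isSep_singleton r x, ?_⟩
      rw [← mul_div_assoc]
      simpa using Real.rpow_le_one (by positivity) ((div_le_one hr).2 hle) ht
    obtain ⟨ρ, hρ, hρR, S, hSF, hS, hSc⟩ := h x hx R hR hR1
    have hρ0 : 0 < ρ := (by positivity : 0 < η * R).trans_le hρ
    have hsub : ∀ y ∈ S, ∃ T : Finset Y, (T : Set Y) ⊆ closedBall y ρ ∩ F ∧ IsSep r T ∧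
        (η * (ρ / r)) ^ t ≤ T.card := fun y hy =>
      ih ρ hρ0 (by linarith) (by rw [pow_succ] at hRr; linarith) y (hSF hy).2
    choose! T hTF hT hTc using hsub
    have hfar : ∀ y ∈ S, ∀ y' ∈ S, y ≠ y' → ∀ p ∈ T y, ∀ q ∈ T y', r < dist p q := by
      intro y hy y' hy' hne p hp q hq
      have h1 := hS hy hy' hne
      have h2 := mem_closedBall'.1 (hTF y hy hp).1
      have h3 := mem_closedBall.1 (hTF y' hy' hq).1
      have h4 := dist_triangle4 y p q y'
      linarith
    refine ⟨S.biUnion T, ?_, ?_, ?_⟩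
    · intro p hp
      obtain ⟨y, hy, hpy⟩ := Finset.mem_biUnion.1 (Finset.mem_coe.1 hp)
      refine ⟨?_, (hTF y hy hpy).2⟩
      have h1 := mem_closedBall.1 (hTF y hy hpy).1
      have h2 := mem_closedBall.1 (hSF hy).1
      have h3 := dist_triangle p y x
      rw [mem_closedBall]
      linarith
    · intro p hp q hq hpq
      obtain ⟨y, hy, hpy⟩ := Finset.mem_biUnion.1 (Finset.mem_coe.1 hp)
      obtain ⟨y', hy', hqy⟩ := Finset.mem_biUnion.1 (Finset.mem_coe.1 hq)
      rcases eq_or_ne y y' with rfl | hne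
      · exact hT y hy hpy hqy hpq
      · exact (hfar y hy y' hy' hne p hpy q hqy).le
    · rw [Finset.card_biUnion fun y hy y' hy' hne => Finset.disjoint_left.2 fun p hp hp' => by
        have := hfar y hy y' hy' hne p hp p hp'
        rw [dist_self] at this
        linarith]
      push_cast
      calc (η * (R / r)) ^ t = (R / ρ) ^ t * (η * (ρ / r)) ^ t := by
            rw [← Real.mul_rpow (by positivity) (by positivity)]
            congr 1
            field_simp
        _ ≤ S.card * (η * (ρ / r)) ^ t := by gcongr
        _ = ∑ _y ∈ S, (η * (ρ / r)) ^ t := by rw [Finset.sum_const, nsmul_eq_mul]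
        _ ≤ _ := Finset.sum_le_sum hTc

/-- If `F` is not `t`-homogeneous, some ball of `F` is sparse at an arbitrarily long range of
scales. -/
theorem exists_sparse_ball {t η : ℝ} (ht : 0 ≤ t) (hη : 0 < η) (hη1 : η ≤ 1)
    (hF : ¬ ∃ C : ℝ, 0 < C ∧ IsHomogeneous F t C) :
    ∃ x ∈ F, ∃ R, 0 < R ∧ R < 1 ∧ ∀ ρ, η * R ≤ ρ → ρ ≤ R / 2 →
      ∀ S : Finset (EuclideanSpace ℝ (Fin d)), (S : Set _) ⊆ closedBall x (R / 2) ∩ F →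
        IsSep (4 * ρ) S → (S.card : ℝ) < (R / ρ) ^ t := by
  by_contra! hcon
  refine hF ⟨(η / (√d + 1)) ^ t, by positivity, fun R hR hR1 r hr _ x hx => ?_⟩
  have hr' : 0 < (√d + 1) * r := by positivity
  obtain ⟨m, hm⟩ := pow_unbounded_of_one_lt (R / ((√d + 1) * r)) one_lt_two
  obtain ⟨S, hSF, hS, hSc⟩ := exists_isSep_of_forall_branching ht hη hη1 hcon m hr' R hR hR1
    ((div_le_iff₀ hr').1 hm.le) x hx
  have h1 := hS.card_le_coverNum hSF (isBounded_closedBall.subset inter_subset_left) hr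
    (by linarith)
  calc (η / (√d + 1)) ^ t * (R / r) ^ t = (η * (R / ((√d + 1) * r))) ^ t := by
        rw [← Real.mul_rpow (by positivity) (by positivity)]
        congr 1
        field_simp
    _ ≤ S.card := hSc
    _ ≤ _ := by exact_mod_cast h1

/-- The centre of the unit cube. -/
noncomputable def centre (d : ℕ) : EuclideanSpace ℝ (Fin d) := WithLp.toLp 2 fun _ => 1 / 2

theorem closedBall_centre_subset : closedBall (centre d) (1 / 2) ⊆ unitCube d := by
  have h : (centre d - WithLp.toLp 2 fun _ => 1 / 2) = 0 := sub_self _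
  simpa only [h, unitCube] using closedBall_subset_cube (centre d) 1

theorem centre_mem_interior : centre d ∈ interior (unitCube d) :=
  mem_interior.2 ⟨ball (centre d) (1 / 2), ball_subset_closedBall.trans closedBall_centre_subset,
    isOpen_ball, mem_ball_self (by norm_num)⟩

theorem isCompact_unitCube : IsCompact (unitCube d) := by
  refine Metric.isCompact_of_isClosed_isBounded ?_ ?_
  · have : unitCube d = ⋂ i, {x | (0 : EuclideanSpace ℝ (Fin d)) i ≤ x i ∧
        x i ≤ (0 : EuclideanSpace ℝ (Fin d)) i + 1} := by
      ext x
      simp [unitCube, cube]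
    rw [this]
    exact isClosed_iInter fun i => IsClosed.and (isClosed_le (by fun_prop) (by fun_prop))
      (isClosed_le (by fun_prop) (by fun_prop))
  · exact Metric.isBounded_iff.2 ⟨√d * 1, fun x hx y hy => dist_le_of_mem_cube zero_le_one hx hy⟩

/-- If `F` is not `t`-homogeneous, some miniset of `F` through the centre of the unit cube is
sparse at an arbitrarily long range of scales. -/
theorem exists_sparse_miniset (hFc : IsCompact F) {t η : ℝ} (ht : 0 ≤ t) (hη : 0 < η)
    (hη1 : η ≤ 1) (hF : ¬ ∃ C : ℝ, 0 < C ∧ IsHomogeneous F t C) :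
    ∃ D, IsMiniset F D ∧ IsCompact D ∧ centre d ∈ D ∧ ∀ δ, 8 * (√d + 1) * η ≤ δ →
      δ ≤ 4 * (√d + 1) → ∀ S : Finset (EuclideanSpace ℝ (Fin d)), (S : Set _) ⊆ D →
        IsSep δ S → (S.card : ℝ) ≤ (8 * (√d + 1) / δ) ^ t := by
  obtain ⟨x, hx, R, hR, hR1, h⟩ := exists_sparse_ball ht hη hη1 hF
  have hd : 0 ≤ √(d : ℝ) := by positivity
  -- Chosen so that the unit cube, of diameter at most `√d`, pulls back into `closedBall x (R / 2)`.
  set c : ℝ := 2 * (√d + 1) / R with hc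
  have hc0 : 0 < c := by positivity
  have hc1 : 1 ≤ c := by rw [hc, one_le_div hR]; linarith
  set τ := centre d - c • x with hτ
  have hxτ : c • x + τ = centre d := by rw [hτ]; abel
  refine ⟨_, ⟨c, hc1, τ, rfl⟩, (hFc.image (by fun_prop)).inter isCompact_unitCube,
    ⟨⟨x, hx, hxτ⟩, interior_subset centre_mem_interior⟩, fun δ hδ hδ' S hSD hS => ?_⟩
  have hδ0 : 0 < δ := (by positivity : 0 < 8 * (√d + 1) * η).trans_le hδ
  obtain ⟨T, hT, hTc, hTs⟩ := hS.image_affine (inv_pos.2 hc0) (-(c⁻¹ • τ))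
  have hinv : ∀ p : EuclideanSpace ℝ (Fin d), c⁻¹ • (c • p + τ) + -(c⁻¹ • τ) = p := fun p => by
    rw [smul_add, inv_smul_smul₀ hc0.ne', add_neg_cancel_right]
  have hTF : (T : Set _) ⊆ closedBall x (R / 2) ∩ F := by
    rw [hT]
    rintro _ ⟨q, hq, rfl⟩
    obtain ⟨⟨p, hp, rfl⟩, hcube⟩ := hSD hq
    simp only [hinv]
    refine ⟨?_, hp⟩
    have h1 := dist_le_of_mem_cube zero_le_one hcube (interior_subset centre_mem_interior)
    rw [← hxτ, dist_affine hc0.le, hc, div_mul_eq_mul_div, div_le_iff₀ hR] at h1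
    rw [mem_closedBall]
    nlinarith [dist_nonneg (x := p) (y := x)]
  have hsep : c⁻¹ * δ = 4 * (δ * R / (8 * (√d + 1))) := by
    rw [hc]; field_simp; norm_num
  rw [hsep] at hTs
  have h1 := h (δ * R / (8 * (√d + 1)))
    (by rw [le_div_iff₀ (by positivity)]; nlinarith)
    (by rw [div_le_iff₀ (by positivity)]; nlinarith) T hTF hTs
  rw [hTc, show R / (δ * R / (8 * (√d + 1))) = 8 * (√d + 1) / δ by field_simp] at h1
  exact h1.le

/-- Blaschke selection in a compact set. -/
theorem exists_subseq_tendsto_hausdorffEDist {Y : Type*} [MetricSpace Y] {X : Set Y}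
    (hX : IsCompact X) {D : ℕ → Set Y} (hD : ∀ n, IsCompact (D n)) (hne : ∀ n, (D n).Nonempty)
    (hDX : ∀ n, D n ⊆ X) :
    ∃ E, IsCompact E ∧ E ⊆ X ∧ ∃ φ : ℕ → ℕ, StrictMono φ ∧
      Tendsto (fun n => hausdorffEDist (D (φ n)) E) atTop (𝓝 0) := by
  have : CompactSpace X := isCompact_iff_compactSpace.1 hX
  have himg : ∀ n, Subtype.val '' (Subtype.val ⁻¹' D n : Set X) = D n := fun n => by
    rw [Subtype.image_preimage_coe, inter_eq_right.2 (hDX n)]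
  let K : ℕ → TopologicalSpace.NonemptyCompacts X := fun n =>
    ⟨⟨Subtype.val ⁻¹' D n, by rw [Subtype.isCompact_iff, himg]; exact hD n⟩, by
      obtain ⟨x, hx⟩ := hne n
      exact ⟨⟨x, hDX n hx⟩, hx⟩⟩
  obtain ⟨L, φ, hφ, hL⟩ := CompactSpace.tendsto_subseq K
  refine ⟨Subtype.val '' (L : Set X), L.isCompact.image continuous_subtype_val,
    Subtype.coe_image_subset _ _, φ, hφ, ?_⟩
  have h := tendsto_iff_edist_tendsto_0.1 hL
  refine h.congr fun n => ?_
  rw [← himg (φ n), hausdorffEDist_image isometry_subtype_coe]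
  rfl

/-- The constant `K` contributes only `log K / log r`, which vanishes as `r → 0`. -/
theorem upperBoxDim_le {A : Set (EuclideanSpace ℝ (Fin d))} {K r₀ : ℝ} {s : ℝ≥0} (hK : 0 < K)
    (hr₀ : 0 < r₀) (h : ∀ r, 0 < r → r ≤ r₀ → (coverNum r A : ℝ) ≤ (K / r) ^ (s : ℝ)) :
    upperBoxDim A ≤ s := by
  have hlim : Tendsto (fun r : ℝ => ENNReal.ofReal (s * (1 - Real.log K / Real.log r))) (𝓝[>] 0)
      (𝓝 s) := by
    have h1 : Tendsto (fun r : ℝ => s * (1 - Real.log K / Real.log r)) (𝓝[>] 0)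
        (𝓝 (s * (1 - 0))) :=
      ((Tendsto.const_div_atBot Real.tendsto_log_nhdsGT_zero _).const_sub _).const_mul _
    simpa using ENNReal.tendsto_ofReal h1
  rw [← hlim.limsup_eq]
  refine limsup_le_limsup ?_
  filter_upwards [Ioo_mem_nhdsGT (show 0 < min (min r₀ K) 1 by positivity)] with r hr
  have hr0 : 0 < r := hr.1
  have hrr : r < r₀ := hr.2.trans_le ((min_le_left _ _).trans (min_le_left _ _))
  have hrK : r < K := hr.2.trans_le ((min_le_left _ _).trans (min_le_right _ _))
  have hlog : Real.log r < 0 := Real.log_neg hr0 (hr.2.trans_le (min_le_right _ _))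
  refine ENNReal.ofReal_le_ofReal ?_
  have h1 : Real.log (coverNum r A) ≤ s * (Real.log K - Real.log r) := by
    rw [← Real.log_div hK.ne' hr0.ne', ← Real.log_rpow (by positivity)]
    rcases Nat.eq_zero_or_pos (coverNum r A) with h0 | h0
    · rw [h0, Nat.cast_zero, Real.log_zero]
      exact Real.log_nonneg (Real.one_le_rpow ((one_le_div hr0).2 hrK.le) s.coe_nonneg)
    · exact Real.log_le_log (by exact_mod_cast h0) (h r hr0 hrr.le)
  rw [div_le_iff_of_neg hlog, mul_assoc, sub_mul, div_mul_cancel₀ _ hlog.ne]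
  linarith

theorem not_isHomogeneous_of_lowerDim_lt {t : ℝ≥0} (ht : lowerDim F < t) :
    ¬ ∃ C : ℝ, 0 < C ∧ IsHomogeneous F t C := fun h =>
  ht.not_ge (le_iSup₂ (f := fun (s : ℝ≥0) (_ : ∃ C : ℝ, 0 < C ∧ IsHomogeneous F s C) =>
    (s : ℝ≥0∞)) t h)

/-- The gallery of `F` contains a set whose upper box dimension is at most the lower dimension
of `F`. -/
theorem exists_upperBoxDim_le (hFc : IsCompact F) (hne : F.Nonempty) :
    ∃ E ∈ gallery F, upperBoxDim E ≤ lowerDim F := by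
  have hmem : ∀ {D : ℕ → Set (EuclideanSpace ℝ (Fin d))} {E}, (∀ n, IsMiniset F (D n)) →
      (∀ n, centre d ∈ D n) → IsCompact E → E ⊆ unitCube d →
      Tendsto (fun n => hausdorffEDist (D n) E) atTop (𝓝 0) → E ∈ gallery F := by
    intro D E hD hz hE hEX hlim
    refine ⟨⟨hE, hEX, D, hD, hlim⟩, centre d, ?_, centre_mem_interior⟩
    rw [mem_iff_infEDist_zero_of_closed hE.isClosed]
    exact le_antisymm (ge_of_tendsto' hlim fun n => infEDist_le_hausdorffEDist_of_mem (hz n))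
      zero_le
  -- Any gallery set serves in the infinite case; a translate of `F` cut by the cube is one.
  rcases eq_or_ne (lowerDim F) ⊤ with htop | htop
  · obtain ⟨x, hx⟩ := hne
    refine ⟨((fun y => (1 : ℝ) • y + (centre d - x)) '' F) ∩ unitCube d,
      hmem (D := fun _ => ((fun y => (1 : ℝ) • y + (centre d - x)) '' F) ∩ unitCube d)
        (fun _ => ⟨1, le_rfl, _, rfl⟩) (fun _ => ⟨⟨x, hx, by simp⟩, interior_subset centre_mem_interior⟩)
        ((hFc.image (by fun_prop)).inter isCompact_unitCube) inter_subset_right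
        (by simp only [hausdorffEDist_self, tendsto_const_nhds]), by simp [htop]⟩
  lift lowerDim F to ℝ≥0 using htop with s hs
  have hsparse : ∀ n : ℕ, ∃ D, IsMiniset F D ∧ IsCompact D ∧ centre d ∈ D ∧
      ∀ δ, 8 * (√d + 1) * (1 / ((n : ℝ) + 1)) ≤ δ → δ ≤ 4 * (√d + 1) →
        ∀ S : Finset (EuclideanSpace ℝ (Fin d)), (S : Set _) ⊆ D → IsSep δ S →
          (S.card : ℝ) ≤ (8 * (√d + 1) / δ) ^ ((s : ℝ) + 1 / ((n : ℝ) + 1)) := fun n => by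
    have hn : (0 : ℝ) < 1 / ((n : ℝ) + 1) := by positivity
    refine exists_sparse_miniset hFc (by positivity) hn ?_ ?_
    · rw [div_le_one (by positivity)]
      linarith [n.cast_nonneg (α := ℝ)]
    · have hlt : s < s + ⟨1 / ((n : ℝ) + 1), hn.le⟩ := lt_add_of_pos_right s hn
      exact not_isHomogeneous_of_lowerDim_lt (hs ▸ ENNReal.coe_lt_coe.2 hlt)
  choose D hD hDc hDz hDs using hsparse
  obtain ⟨E, hEc, hEX, φ, hφ, hlim⟩ := exists_subseq_tendsto_hausdorffEDist isCompact_unitCube hDc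
    (fun n => ⟨_, hDz n⟩) (fun n => by obtain ⟨c, -, t, h⟩ := hD n; exact h ▸ inter_subset_right)
  refine ⟨E, hmem (fun n => hD (φ n)) (fun n => hDz (φ n)) hEc hEX hlim, ?_⟩
  refine upperBoxDim_le (K := 32 * (√d + 1)) (r₀ := 4 * (√d + 1)) (by positivity) (by positivity)
    fun r hr hr₀ => ?_
  obtain ⟨S, hSE, hS, hSc⟩ := exists_isSep_card_eq_coverNum hr E
  have hinv : Tendsto (fun n => 1 / ((φ n : ℝ) + 1)) atTop (𝓝 0) :=
    tendsto_one_div_add_atTop_nhds_zero_nat.comp hφ.tendsto_atTop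
  -- With `r` fixed, the `r / 2`-separated set in `E` moves by `r / 8` into `D (φ n)`, leaving `δ =
  -- r / 4`; then the exponent tends to `s`.
  have hexp : Tendsto (fun n => (8 * (√d + 1) / (r / 4)) ^ ((s : ℝ) + 1 / ((φ n : ℝ) + 1))) atTop
      (𝓝 ((8 * (√d + 1) / (r / 4)) ^ ((s : ℝ) + 0))) :=
    (Real.continuousAt_const_rpow (by positivity)).tendsto.comp (hinv.const_add _)
  rw [add_zero, show 8 * (√d + 1) / (r / 4) = 32 * (√d + 1) / r by field_simp; norm_num] at hexp
  refine ge_of_tendsto hexp ?_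
  have hsmall : Tendsto (fun n => 8 * (√d + 1) * (1 / ((φ n : ℝ) + 1))) atTop (𝓝 0) := by
    simpa using hinv.const_mul (8 * (√d + 1))
  filter_upwards [hlim.eventually (gt_mem_nhds (ENNReal.ofReal_pos.2 (by positivity : 0 < r / 8))),
    hsmall.eventually (gt_mem_nhds (by positivity : 0 < r / 4))] with n hn hn'
  obtain ⟨T, hTD, hTc, hTs, -⟩ := hS.exists_perturb hSE (by linarith)
    (hausdorffEDist_comm.trans_lt hn)
  have h1 := hDs (φ n) (r / 4) hn'.le (by linarith) T hTD (hTs.anti (by linarith))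
  rwa [hTc, hSc, show 8 * (√d + 1) / (r / 4) = 32 * (√d + 1) / r by field_simp; norm_num] at h1

end Microset

theorem theorem1p1 (d : ℕ) (F : Set (EuclideanSpace ℝ (Fin d))) (hF : IsCompact F)
    (hne : F.Nonempty) :
    IsLeast (dimH '' Microset.gallery F) (Microset.lowerDim F) ∧
      IsLeast (Microset.upperBoxDim '' Microset.gallery F) (Microset.lowerDim F) := by
  have hbox : ∀ E ∈ Microset.gallery F, dimH E ≤ Microset.upperBoxDim E := fun E hE =>
    Microset.dimH_le_upperBoxDim hE.1.1.isBounded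
  obtain ⟨E, hE, hEF⟩ := Microset.exists_upperBoxDim_le hF hne
  have hlow := fun {E} => Microset.lowerDim_le_dimH (F := F) (E := E)
  refine ⟨⟨⟨E, hE, ((hbox E hE).trans hEF).antisymm (hlow hE)⟩, ?_⟩,
    ⟨E, hE, hEF.antisymm ((hlow hE).trans (hbox E hE))⟩, ?_⟩
  · rintro _ ⟨E', hE', rfl⟩
    exact hlow hE'
  · rintro _ ⟨E', hE', rfl⟩
    exact (hlow hE').trans (hbox E' hE')
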